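/- Let $M$ be a connected smooth ($C^\infty$, Hausdorff, second countable) manifold of dimension $n\ge 3$ without boundary, let $\alpha(x,y)=\sqrt{a_{ij}(x)y^iy^j}$ be (the norm of) a smooth Riemannian metric on $M$, and let $\beta=b_i(x)y^i$ be a smooth closed $1$-form on $M$. Let $\phi:\mathbb R\to\mathbb R$ be one of the functions (i) $\phi(s)=s^2+2s+2$, (ii) $\phi(s)=s^2+s+2$, (iii) $\phi(s)=(s+2)^2$, and put $F=\alpha\,\phi(\beta/\alpha)$ on nonzero tangent vectors and $F=0$ on zero vectors. Suppose that $F$ is a Finsler metric on $M$, i.e. $F:TM\to[0,\infty)$ is $C^\infty$ on $TM\setminus 0$, $F(x,\lambda y)=\lambda F(x,y)$ for all $\lambda>0$, and the Hessian $\left(\left[\tfrac12F^2\right]_{y^iy^j}\right)$ is positive definite at every $(x,y)$ with $y\ne0$. Suppose also that $F$ is non-Riemannian, i.e. $F$ is not the norm of any smooth Riemannian metric on $M$. Then $F$ is with reversible geodesics: whenever $\gamma:[0,1]\to M$ is a geodesic of $F$, the reverse curve $t\mapsto\gamma(1-t)$ is also a geodesic of $F$. Here a geodesic of $F$ is a smooth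 curve $\gamma:[0,1]\to M$ with $\dot\gamma(t)\neq0$ for all $t$ that is a critical point of the length $L_F(\gamma)=\int_0^1F(\gamma(t),\dot\gamma(t))\,dt$ for fixed end points: for every smooth variation $H:(-\varepsilon,\varepsilon)\times[0,1]\to M$ with $H(0,\cdot)=\gamma$, $H(s,0)=\gamma(0)$ and $H(s,1)=\gamma(1)$ one has $\frac{d}{ds}\big|_{s=0}L_F(H(s,\cdot))=0$. The parametrization of a geodesic is not required to have constant $F$-speed. -/

import Mathlib

open Set Bundle
open scoped Manifold ContDiff Topology

noncomputable section

section Finsler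

variable {n : ℕ} {M : Type*} [TopologicalSpace M] [ChartedSpace (EuclideanSpace ℝ (Fin n)) M]

/-- A smooth Riemannian metric on an `n`-dimensional smooth manifold `M`. -/
abbrev SmoothRiemannianMetric (n : ℕ) (M : Type*) [TopologicalSpace M]
    [ChartedSpace (EuclideanSpace ℝ (Fin n)) M] [IsManifold (𝓡 n) ∞ M] : Type _ :=
  ContMDiffRiemannianMetric (IB := 𝓡 n) (n := ∞) (EuclideanSpace ℝ (Fin n))
    (fun x : M ↦ TangentSpace (𝓡 n) x)

/-- The norm `α(x, y) = √(a_x(y, y))` of a Riemannian metric `a`, as a function on `TM`. -/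
def riemannianNorm [IsManifold (𝓡 n) ∞ M] (a : SmoothRiemannianMetric n M)
    (p : TangentBundle (𝓡 n) M) : ℝ :=
  √(a.inner p.proj p.snd p.snd)

/-- The `(α, β)`-function `F = α φ(β / α)` on `TM`. At zero vectors it takes the value `0`. -/
def alphaBeta [IsManifold (𝓡 n) ∞ M] (a : SmoothRiemannianMetric n M)
    (β : (x : M) → TangentSpace (𝓡 n) x →L[ℝ] ℝ) (φ : ℝ → ℝ)
    (p : TangentBundle (𝓡 n) M) : ℝ :=
  riemannianNorm a p * φ (β p.proj p.snd / riemannianNorm a p)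

/-- `β` is a smooth `1`-form on `M`, i.e. a smooth section of the cotangent bundle. -/
def IsSmoothOneForm [IsManifold (𝓡 n) 1 M] (β : (x : M) → TangentSpace (𝓡 n) x →L[ℝ] ℝ) : Prop :=
  ContMDiff (𝓡 n) ((𝓡 n).prod 𝓘(ℝ, EuclideanSpace ℝ (Fin n) →L[ℝ] ℝ)) ∞
    (fun x ↦ TotalSpace.mk' (EuclideanSpace ℝ (Fin n) →L[ℝ] ℝ)
      (E := fun x : M ↦ TangentSpace (𝓡 n) x →L[ℝ] Bundle.Trivial M ℝ x) x (β x))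

/-- The expression of the `1`-form `β` in the chart at `x₀`, i.e. its pullback by the inverse of
that chart: `u ↦ ∑ i, b_i(u) du^i`. -/
def oneFormInChart (β : (x : M) → TangentSpace (𝓡 n) x →L[ℝ] ℝ) (x₀ : M)
    (u : EuclideanSpace ℝ (Fin n)) : EuclideanSpace ℝ (Fin n) →L[ℝ] ℝ :=
  (β ((extChartAt (𝓡 n) x₀).symm u)).comp
    (mfderiv 𝓘(ℝ, EuclideanSpace ℝ (Fin n)) (𝓡 n) (extChartAt (𝓡 n) x₀).symm u)

/-- The `1`-form `β` is closed: `dβ = 0`, i.e. `∂_i b_j = ∂_j b_i` in charts covering `M`. -/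
def IsClosedOneForm (β : (x : M) → TangentSpace (𝓡 n) x →L[ℝ] ℝ) : Prop :=
  ∀ x₀ : M, ∀ u ∈ (extChartAt (𝓡 n) x₀).target, ∀ v w : EuclideanSpace ℝ (Fin n),
    fderiv ℝ (oneFormInChart β x₀) u v w = fderiv ℝ (oneFormInChart β x₀) u w v

/-- `F : TM → [0, ∞)` is a Finsler metric on `M`. -/
structure IsFinslerMetric [IsManifold (𝓡 n) 1 M] (F : TangentBundle (𝓡 n) M → ℝ) : Prop where
  nonneg : ∀ p, 0 ≤ F p
  /-- `F` is smooth on the slit tangent bundle. -/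
  smooth : ContMDiffOn (𝓡 n).tangent 𝓘(ℝ, ℝ) ∞ F {p | p.snd ≠ 0}
  /-- `F` is positively homogeneous of degree one on each tangent space. -/
  pos_homogeneous : ∀ (x : M) (y : TangentSpace (𝓡 n) x) (c : ℝ), 0 < c →
    F ⟨x, c • y⟩ = c * F ⟨x, y⟩
  /-- The fundamental form `g_y(v, v) = ½ ∂²/∂t² F²(x, y + t v)` at `t = 0`, that is, the quadratic
  form of the Hessian of `½ F²` along the fibre, is positive definite at every `y ≠ 0`. -/
  strongly_convex : ∀ (x : M) (y v : TangentSpace (𝓡 n) x), y ≠ 0 → v ≠ 0 →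
    0 < iteratedDeriv 2 (fun t : ℝ ↦ F ⟨x, y + t • v⟩ ^ 2 / 2) 0

/-- `F` is Riemannian: it is the norm of some smooth Riemannian metric on `M`. -/
def IsRiemannianNorm [IsManifold (𝓡 n) ∞ M] (F : TangentBundle (𝓡 n) M → ℝ) : Prop :=
  ∃ h : SmoothRiemannianMetric n M, ∀ p, F p = riemannianNorm h p

/-- The canonical lift `t ↦ (γ(t), γ'(t))` to `TM` of a curve `γ : [0, 1] → M`
(one-sided derivatives are used at the end points). -/
def canonicalLift (γ : ℝ → M) (t : ℝ) : TangentBundle (𝓡 n) M :=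
  ⟨γ t, mfderivWithin 𝓘(ℝ, ℝ) (𝓡 n) γ (Icc 0 1) t (1 : ℝ)⟩

/-- The length `∫₀¹ F(γ(t), γ'(t)) dt` of a curve `γ : [0, 1] → M`. -/
def finslerLength (F : TangentBundle (𝓡 n) M → ℝ) (γ : ℝ → M) : ℝ :=
  ∫ t in (0 : ℝ)..1, F (canonicalLift γ t)

/-- `H` is a smooth variation, defined on `(-ε, ε) × [0, 1]`, of the curve `γ : [0, 1] → M` with
fixed end points. -/
structure IsProperVariation (γ : ℝ → M) (ε : ℝ) (H : ℝ → ℝ → M) : Prop where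
  pos : 0 < ε
  smooth : ContMDiffOn 𝓘(ℝ, ℝ × ℝ) (𝓡 n) ∞ (fun q : ℝ × ℝ ↦ H q.1 q.2) (Ioo (-ε) ε ×ˢ Icc 0 1)
  base : ∀ t ∈ Icc (0 : ℝ) 1, H 0 t = γ t
  left : ∀ s ∈ Ioo (-ε) ε, H s 0 = γ 0
  right : ∀ s ∈ Ioo (-ε) ε, H s 1 = γ 1

/-- `γ : [0, 1] → M` is a geodesic of `F`: a smooth regular curve which is a critical point of
the `F`-length among curves with the same end points. Its parametrization is not required
to have constant speed. -/
structure IsGeodesic (F : TangentBundle (𝓡 n) M → ℝ) (γ : ℝ → M) : Prop where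
  smooth : ContMDiffOn 𝓘(ℝ, ℝ) (𝓡 n) ∞ γ (Icc 0 1)
  regular : ∀ t ∈ Icc (0 : ℝ) 1, (canonicalLift (n := n) γ t).snd ≠ 0
  critical : ∀ (ε : ℝ) (H : ℝ → ℝ → M), IsProperVariation (n := n) γ ε H →
    HasDerivAt (fun s ↦ finslerLength F (H s)) 0 0

/-- `F` is with reversible geodesics: along with any geodesic `γ(t)`, the reverse curve
`γ(1 - t)` is also a geodesic. -/
def HasReversibleGeodesics (F : TangentBundle (𝓡 n) M → ℝ) : Prop :=
  ∀ γ : ℝ → M, IsGeodesic F γ → IsGeodesic F (fun t ↦ γ (1 - t))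

end Finsler

end

/-! Each of the three `φ` has the form `s ^ 2 + k * s + c`, so `F = β²/α + kβ + cα` off the zero
section, and only `kβ` is odd in `y`. Hence `F(x, -y) = F(x, y) - 2kβ(y)`: reversing a curve changes
its length by `-2k` times the integral of `β` (`alphaBeta_neg`, `finslerLength_reverse`).

Since `β` is closed, this integral does not change along a variation with fixed end points
(`IsClosedOneForm.integral_canonicalLift_eq`): the pullback of `β` to the convex strip `(-ε, ε) ×
[0, 1]` has a primitive, which is constant on the two edges that `H` collapses to points. So the
lengths of the varied curves and of their reverses differ by a constant, and criticality passes from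
a geodesic to its reverse. -/

/-! ### Pullbacks of closed one-forms and their primitives -/

section Pullback

variable {n : ℕ} {M : Type*} [TopologicalSpace M] [ChartedSpace (EuclideanSpace ℝ (Fin n)) M]
  [IsManifold (𝓡 n) ∞ M] {E : Type*} [NormedAddCommGroup E] [NormedSpace ℝ E]

/-- The derivative of a smooth map in a constant direction, as a smooth map to the tangent bundle. -/
theorem contMDiffOn_mfderivWithin_const {f : E → M} {s : Set E}
    (hf : ContMDiffOn 𝓘(ℝ, E) (𝓡 n) ∞ f s) (hs : UniqueDiffOn ℝ s) (v : E) :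
    ContMDiffOn 𝓘(ℝ, E) (𝓡 n).tangent ∞
      (fun u ↦ (⟨f u, mfderivWithin 𝓘(ℝ, E) (𝓡 n) f s u v⟩ : TangentBundle (𝓡 n) M)) s := by
  have h1 := hf.contMDiffOn_tangentMapWithin (m := ∞) (by simp) hs.uniqueMDiffOn
  have h2 : ContMDiff 𝓘(ℝ, E) 𝓘(ℝ, E).tangent ∞
      (fun u ↦ (⟨u, v⟩ : TangentBundle 𝓘(ℝ, E) E)) :=
    (contMDiff_vectorSpace_iff_contDiff (V := fun _ : E ↦ v)).2 contDiff_const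
  exact h1.comp h2.contMDiffOn (fun u hu ↦ hu)

theorem IsSmoothOneForm.contMDiffOn_apply {β : (x : M) → TangentSpace (𝓡 n) x →L[ℝ] ℝ}
    (hβ : IsSmoothOneForm β) {s : Set E} {V : E → TangentBundle (𝓡 n) M}
    (hV : ContMDiffOn 𝓘(ℝ, E) (𝓡 n).tangent ∞ V s) :
    ContMDiffOn 𝓘(ℝ, E) 𝓘(ℝ, ℝ) ∞ (fun u ↦ β (V u).proj (V u).snd) s := by
  intro u hu
  have hb : ContMDiffWithinAt 𝓘(ℝ, E) (𝓡 n) ∞ (fun u ↦ (V u).proj) s u :=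
    (contMDiffWithinAt_totalSpace.1 (hV u hu)).1
  have h1 := (hβ.contMDiffAt (x := (V u).proj)).comp_contMDiffWithinAt u hb
  have h2 := ContMDiffWithinAt.clm_bundle_apply (F₁ := EuclideanSpace ℝ (Fin n)) (F₂ := ℝ)
    (E₂ := Bundle.Trivial M ℝ) (b := fun u ↦ (V u).proj) (ϕ := fun u ↦ β (V u).proj)
    (v := fun u ↦ (V u).snd) h1 (hV u hu)
  exact (contMDiffWithinAt_totalSpace.1 h2).2

theorem IsSmoothOneForm.contDiffOn_oneFormInChart
    {β : (x : M) → TangentSpace (𝓡 n) x →L[ℝ] ℝ} (hβ : IsSmoothOneForm β) (x₀ : M) :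
    ContDiffOn ℝ ∞ (oneFormInChart β x₀) (extChartAt (𝓡 n) x₀).target := by
  have ho := isOpen_extChartAt_target (I := 𝓡 n) x₀
  rw [contDiffOn_clm_apply]
  intro v
  have h := hβ.contMDiffOn_apply (contMDiffOn_mfderivWithin_const
    (contMDiffOn_extChartAt_symm (I := 𝓡 n) (n := ∞) x₀) ho.uniqueDiffOn v)
  refine (contMDiffOn_iff_contDiffOn.1 h).congr fun u hu ↦ ?_
  simp only [oneFormInChart, mfderivWithin_of_isOpen ho hu]
  rfl

/-- The pullback of a `1`-form on `M` by a map defined on a subset of a normed space. -/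
noncomputable def pullbackOneForm (β : (x : M) → TangentSpace (𝓡 n) x →L[ℝ] ℝ) (f : E → M)
    (s : Set E) (q : E) : E →L[ℝ] ℝ :=
  (β (f q)).comp (mfderivWithin 𝓘(ℝ, E) (𝓡 n) f s q)

/-- Closedness is formulated in charts; this local formula brings it to the pullback. It is the
chain rule for `f = e⁻¹ ∘ (e ∘ f)`, valid near `q` within `s`. -/
theorem pullbackOneForm_eq_oneFormInChart_comp (β : (x : M) → TangentSpace (𝓡 n) x →L[ℝ] ℝ)
    {f : E → M} {s : Set E} {q : E} {x₀ : M} (hs : UniqueDiffWithinAt ℝ s q)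
    (hf : ContMDiffWithinAt 𝓘(ℝ, E) (𝓡 n) ∞ f s q) (hx : f q ∈ (extChartAt (𝓡 n) x₀).source) :
    pullbackOneForm β f s q = (oneFormInChart β x₀ (extChartAt (𝓡 n) x₀ (f q))).comp
      (fderivWithin ℝ (fun z ↦ extChartAt (𝓡 n) x₀ (f z)) s q) := by
  have hxs := hx
  rw [extChartAt_source] at hxs
  have hsymm : MDifferentiableAt 𝓘(ℝ, EuclideanSpace ℝ (Fin n)) (𝓡 n)
      (extChartAt (𝓡 n) x₀).symm (extChartAt (𝓡 n) x₀ (f q)) :=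
    ((contMDiffOn_extChartAt_symm (I := 𝓡 n) (n := ∞) x₀).contMDiffAt
      (extChartAt_target_mem_nhds' ((extChartAt (𝓡 n) x₀).map_source hx))).mdifferentiableAt (by simp)
  have he : MDifferentiableWithinAt 𝓘(ℝ, E) 𝓘(ℝ, EuclideanSpace ℝ (Fin n))
      (fun z ↦ extChartAt (𝓡 n) x₀ (f z)) s q :=
    (((contMDiffAt_extChartAt' (I := 𝓡 n) (n := ∞) hxs).comp_contMDiffWithinAt q
      hf).mdifferentiableWithinAt (by simp))
  have hcomp := mfderiv_comp_mfderivWithin q hsymm he hs.uniqueMDiffWithinAt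
  have hev : f =ᶠ[𝓝[s] q]
      ((extChartAt (𝓡 n) x₀).symm ∘ fun z ↦ extChartAt (𝓡 n) x₀ (f z)) := by
    filter_upwards [hf.continuousWithinAt (extChartAt_source_mem_nhds' hx)] with z hz
    exact ((extChartAt (𝓡 n) x₀).left_inv hz).symm
  have hfq := (extChartAt (𝓡 n) x₀).left_inv hx
  have hd := hev.mfderivWithin_eq (I := 𝓘(ℝ, E)) (I' := 𝓡 n) hfq.symm
  rw [hcomp, mfderivWithin_eq_fderivWithin] at hd
  unfold pullbackOneForm oneFormInChart
  ext w
  have h2 := DFunLike.congr_fun hd w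
  simp only [ContinuousLinearMap.comp_apply]
  -- The base points `e⁻¹ (e (f q))` and `f q` are only propositionally equal, so the base point is
  -- generalized before substituting.
  have key : ∀ (y : M) (hy : y = f q) (a : TangentSpace (𝓡 n) (f q))
      (b : TangentSpace (𝓡 n) y), (a : EuclideanSpace ℝ (Fin n)) = b → β (f q) a = β y b := by
    rintro y rfl a b rfl
    rfl
  exact key _ hfq _ _ h2

/-- With `B` the chart expression of `β` and `h = e ∘ f`, differentiating `B(h) ∘ dh` gives `dB(dh
v)(dh w) + B(d²h(v, w))`. The first term is symmetric because `β` is closed, the second by symmetry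
of second derivatives, which at boundary points of `s` relies on `s ⊆ closure (interior s)`. -/
theorem exists_hasFDerivWithinAt_pullbackOneForm_symm
    {β : (x : M) → TangentSpace (𝓡 n) x →L[ℝ] ℝ} (hβ : IsSmoothOneForm β)
    (hβ' : IsClosedOneForm β) {f : E → M} {s : Set E}
    (hf : ContMDiffOn 𝓘(ℝ, E) (𝓡 n) ∞ f s) (hs : UniqueDiffOn ℝ s)
    (hs' : s ⊆ closure (interior s)) {q : E} (hq : q ∈ s) :
    ∃ D : E →L[ℝ] E →L[ℝ] ℝ, HasFDerivWithinAt (pullbackOneForm β f s) D s q ∧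
      ∀ v w, D v w = D w v := by
  set e := extChartAt (𝓡 n) (f q)
  set h : E → EuclideanSpace ℝ (Fin n) := fun z ↦ e (f z)
  have hsrc : f q ∈ e.source := mem_extChartAt_source (f q)
  have htgt : h q ∈ e.target := e.map_source hsrc
  have hh : ContDiffWithinAt ℝ ∞ h s q :=
    ((contMDiffAt_extChartAt (I := 𝓡 n) (n := ∞)).comp_contMDiffWithinAt q
      (hf q hq)).contDiffWithinAt
  have hB : HasFDerivAt (oneFormInChart β (f q)) (fderiv ℝ (oneFormInChart β (f q)) (h q)) (h q) :=
    (((hβ.contDiffOn_oneFormInChart (f q)).contDiffAt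
      (extChartAt_target_mem_nhds' htgt)).differentiableAt (by simp)).hasFDerivAt
  have h1 : HasFDerivWithinAt h (fderivWithin ℝ h s q) s q :=
    (hh.differentiableWithinAt (by simp)).hasFDerivWithinAt
  have h2 : HasFDerivWithinAt (fderivWithin ℝ h s) (fderivWithin ℝ (fderivWithin ℝ h s) s q) s q :=
    ((hh.fderivWithin_right (m := ∞) hs (by simp) hq).differentiableWithinAt
      (by simp)).hasFDerivWithinAt
  have hsymm := (hh.of_le (m := 2) (WithTop.coe_le_coe.2 le_top)).isSymmSndFDerivWithinAt
    (by simp) hs (hs' hq) hq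
  have hev : pullbackOneForm β f s =ᶠ[𝓝[s] q]
      fun z ↦ (oneFormInChart β (f q) (h z)).comp (fderivWithin ℝ h s z) := by
    filter_upwards [(hf q hq).continuousWithinAt (extChartAt_source_mem_nhds (I := 𝓡 n) (f q)),
      self_mem_nhdsWithin] with z hz hzs
    exact pullbackOneForm_eq_oneFormInChart_comp β (hs z hzs) (hf z hzs) hz
  refine ⟨_, ((hB.comp_hasFDerivWithinAt q h1).clm_comp h2).congr_of_eventuallyEq hev
    (hev.self_of_nhdsWithin hq), fun v w ↦ ?_⟩
  have e1 := hsymm v w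
  have e2 := hβ' (f q) (h q) htgt (fderivWithin ℝ h s q v) (fderivWithin ℝ h s q w)
  simp [e1, e2]

/-- Poincaré lemma on a convex set. -/
theorem exists_primitive_pullbackOneForm
    {β : (x : M) → TangentSpace (𝓡 n) x →L[ℝ] ℝ} (hβ : IsSmoothOneForm β)
    (hβ' : IsClosedOneForm β) {f : E → M} {s : Set E}
    (hf : ContMDiffOn 𝓘(ℝ, E) (𝓡 n) ∞ f s) (hs : UniqueDiffOn ℝ s)
    (hs' : s ⊆ closure (interior s)) (hc : Convex ℝ s) :
    ∃ G : E → ℝ, ∀ q ∈ s, HasFDerivWithinAt G (pullbackOneForm β f s q) s q := by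
  choose! D hD using fun q (hq : q ∈ s) ↦
    exists_hasFDerivWithinAt_pullbackOneForm_symm hβ hβ' hf hs hs' hq
  exact hc.exists_forall_hasFDerivWithinAt_of_hasFDerivWithinAt_symmetric
    (fun q hq ↦ (hD q hq).1) (fun q hq v _ w _ ↦ (hD q hq).2 v w)

end Pullback

/-! ### Variations with fixed end points -/

section Variation

variable {n : ℕ} {M : Type*} [TopologicalSpace M] [ChartedSpace (EuclideanSpace ℝ (Fin n)) M]

theorem uniqueDiffOn_Ioo_prod_Icc (ε : ℝ) :
    UniqueDiffOn ℝ (Ioo (-ε) ε ×ˢ Icc (0 : ℝ) 1) :=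
  (uniqueDiffOn_Ioo _ _).prod uniqueDiffOn_Icc_zero_one

theorem Ioo_prod_Icc_subset_closure_interior (ε : ℝ) :
    Ioo (-ε) ε ×ˢ Icc (0 : ℝ) 1 ⊆ closure (interior (Ioo (-ε) ε ×ˢ Icc (0 : ℝ) 1)) := by
  rw [interior_prod_eq, closure_prod_eq, interior_Ioo, interior_Icc, closure_Ioo zero_ne_one]
  exact prod_mono subset_closure subset_rfl

variable {γ : ℝ → M} {ε : ℝ} {H : ℝ → ℝ → M}

/-- Expressing the velocity through the derivative in both variables makes its joint regularity in
`(s, t)` available. -/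
theorem IsProperVariation.canonicalLift_eq (hH : IsProperVariation (n := n) γ ε H) {s t : ℝ}
    (hs : s ∈ Ioo (-ε) ε) (ht : t ∈ Icc (0 : ℝ) 1) :
    canonicalLift (n := n) (H s) t = ⟨H s t, mfderivWithin 𝓘(ℝ, ℝ × ℝ) (𝓡 n)
      (fun q : ℝ × ℝ ↦ H q.1 q.2) (Ioo (-ε) ε ×ˢ Icc 0 1) (s, t) ((0 : ℝ), (1 : ℝ))⟩ := by
  have h1 : HasMFDerivWithinAt 𝓘(ℝ, ℝ) 𝓘(ℝ, ℝ × ℝ) (fun t : ℝ ↦ (s, t)) (Icc 0 1) t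
      (ContinuousLinearMap.inr ℝ ℝ ℝ) :=
    (hasFDerivAt_prodMk_right s t).hasFDerivWithinAt.hasMFDerivWithinAt
  have h2 := ((hH.smooth (s, t) ⟨hs, ht⟩).mdifferentiableWithinAt (by simp)).hasMFDerivWithinAt
  have h3 := (h2.comp t h1 (fun r hr ↦ ⟨hs, hr⟩)).mfderivWithin
    (uniqueDiffOn_Icc_zero_one t ht).uniqueMDiffWithinAt
  have h4 := DFunLike.congr_fun h3 (1 : ℝ)
  exact congrArg (fun v ↦ (⟨H s t, v⟩ : TangentBundle (𝓡 n) M)) h4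

theorem IsProperVariation.pullbackOneForm_snd (hH : IsProperVariation (n := n) γ ε H)
    (β : (x : M) → TangentSpace (𝓡 n) x →L[ℝ] ℝ) {s t : ℝ}
    (hs : s ∈ Ioo (-ε) ε) (ht : t ∈ Icc (0 : ℝ) 1) :
    pullbackOneForm β (fun q : ℝ × ℝ ↦ H q.1 q.2) (Ioo (-ε) ε ×ˢ Icc 0 1) (s, t) (0, 1) =
      β (canonicalLift (n := n) (H s) t).proj (canonicalLift (n := n) (H s) t).snd := by
  rw [hH.canonicalLift_eq hs ht]
  rfl

theorem IsProperVariation.pullbackOneForm_fst (hH : IsProperVariation (n := n) γ ε H)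
    (β : (x : M) → TangentSpace (𝓡 n) x →L[ℝ] ℝ) {s t : ℝ} {x : M}
    (hs : s ∈ Ioo (-ε) ε) (ht : t ∈ Icc (0 : ℝ) 1) (hx : ∀ r ∈ Ioo (-ε) ε, H r t = x) :
    pullbackOneForm β (fun q : ℝ × ℝ ↦ H q.1 q.2) (Ioo (-ε) ε ×ˢ Icc 0 1) (s, t) (1, 0) = 0 := by
  have h1 : HasMFDerivWithinAt 𝓘(ℝ, ℝ) 𝓘(ℝ, ℝ × ℝ) (fun r : ℝ ↦ (r, t)) (Ioo (-ε) ε) s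
      (ContinuousLinearMap.inl ℝ ℝ ℝ) :=
    (hasFDerivAt_prodMk_left s t).hasFDerivWithinAt.hasMFDerivWithinAt
  have h2 := ((hH.smooth (s, t) ⟨hs, ht⟩).mdifferentiableWithinAt (by simp)).hasMFDerivWithinAt
  have hu := (uniqueDiffOn_Ioo (-ε) ε s hs).uniqueMDiffWithinAt
  have h3 := (h2.comp s h1 (fun r hr ↦ mk_mem_prod hr ht)).mfderivWithin hu
  have h5 := ((hasMFDerivWithinAt_const (I := 𝓘(ℝ, ℝ)) (I' := 𝓡 n) x (Ioo (-ε) ε)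
    s).congr_of_eventuallyEq (f₁ := fun r ↦ H r t)
    (eventually_nhdsWithin_of_forall hx) (hx s hs)).mfderivWithin hu
  have h4 := DFunLike.congr_fun (h3.symm.trans h5) (1 : ℝ)
  have h6 : mfderivWithin 𝓘(ℝ, ℝ × ℝ) (𝓡 n)
      (fun q : ℝ × ℝ ↦ H q.1 q.2) (Ioo (-ε) ε ×ˢ Icc 0 1) (s, t) ((1 : ℝ), (0 : ℝ)) = 0 := h4
  exact (congrArg (β (H s t)) h6).trans (map_zero _)

variable [IsManifold (𝓡 n) ∞ M]

theorem IsProperVariation.continuousOn_canonicalLift (hH : IsProperVariation (n := n) γ ε H) :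
    ContinuousOn (fun q : ℝ × ℝ ↦ canonicalLift (n := n) (H q.1) q.2)
      (Ioo (-ε) ε ×ˢ Icc 0 1) :=
  (contMDiffOn_mfderivWithin_const hH.smooth (uniqueDiffOn_Ioo_prod_Icc ε)
    (0, 1)).continuousOn.congr fun _ hq ↦ hH.canonicalLift_eq hq.1 hq.2

theorem IsProperVariation.continuousOn_canonicalLift_right
    (hH : IsProperVariation (n := n) γ ε H) {s : ℝ} (hs : s ∈ Ioo (-ε) ε) :
    ContinuousOn (canonicalLift (n := n) (H s)) (Icc 0 1) :=
  hH.continuousOn_canonicalLift.comp (f := fun t : ℝ ↦ (s, t)) (s := Icc 0 1) (by fun_prop)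
    fun _ ht ↦ ⟨hs, ht⟩

theorem IsSmoothOneForm.continuousOn_canonicalLift {β : (x : M) → TangentSpace (𝓡 n) x →L[ℝ] ℝ}
    (hβ : IsSmoothOneForm β) (hH : IsProperVariation (n := n) γ ε H) {s : ℝ}
    (hs : s ∈ Ioo (-ε) ε) :
    ContinuousOn (fun t ↦ β (canonicalLift (n := n) (H s) t).proj
      (canonicalLift (n := n) (H s) t).snd) (Icc 0 1) := by
  have h := (hβ.contMDiffOn_apply (contMDiffOn_mfderivWithin_const hH.smooth
    (uniqueDiffOn_Ioo_prod_Icc ε) (0, 1))).continuousOn.comp (f := fun t : ℝ ↦ (s, t))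
    (s := Icc 0 1) (by fun_prop) fun _ ht ↦ ⟨hs, ht⟩
  exact h.congr fun t ht ↦ (hH.pullbackOneForm_snd β hs ht).symm

/-- The integral of a closed `1`-form is constant along a variation with fixed end points. -/
theorem IsClosedOneForm.integral_canonicalLift_eq {β : (x : M) → TangentSpace (𝓡 n) x →L[ℝ] ℝ}
    (hβ : IsSmoothOneForm β) (hβ' : IsClosedOneForm β) (hH : IsProperVariation (n := n) γ ε H)
    {s s' : ℝ} (hs : s ∈ Ioo (-ε) ε) (hs' : s' ∈ Ioo (-ε) ε) :
    finslerLength (fun p : TangentBundle (𝓡 n) M ↦ β p.proj p.snd) (H s) =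
      finslerLength (fun p : TangentBundle (𝓡 n) M ↦ β p.proj p.snd) (H s') := by
  obtain ⟨G, hG⟩ := exists_primitive_pullbackOneForm hβ hβ' hH.smooth
    (uniqueDiffOn_Ioo_prod_Icc ε) (Ioo_prod_Icc_subset_closure_interior ε)
    ((convex_Ioo _ _).prod (convex_Icc _ _))
  have hint : ∀ r ∈ Ioo (-ε) ε,
      finslerLength (fun p : TangentBundle (𝓡 n) M ↦ β p.proj p.snd) (H r) =
        G (r, 1) - G (r, 0) := by
    intro r hr
    have hd : ∀ t ∈ Icc (0 : ℝ) 1, HasDerivWithinAt (fun t ↦ G (r, t))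
        (β (canonicalLift (n := n) (H r) t).proj (canonicalLift (n := n) (H r) t).snd)
        (Icc 0 1) t := by
      intro t ht
      have h1 : HasDerivWithinAt (fun t : ℝ ↦ (r, t)) ((0 : ℝ), (1 : ℝ)) (Icc 0 1) t :=
        (hasDerivWithinAt_const t _ r).prodMk (hasDerivWithinAt_id t _)
      have h2 := (hG (r, t) ⟨hr, ht⟩).comp_hasDerivWithinAt t h1 fun z hz ↦ ⟨hr, hz⟩
      rwa [hH.pullbackOneForm_snd β hr ht] at h2
    refine intervalIntegral.integral_eq_sub_of_hasDerivAt_of_le zero_le_one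
      (f := fun t ↦ G (r, t)) (fun t ht ↦ (hd t ht).continuousWithinAt)
      (fun t ht ↦ (hd t (Ioo_subset_Icc_self ht)).hasDerivAt (Icc_mem_nhds ht.1 ht.2)) ?_
    apply ContinuousOn.intervalIntegrable
    rw [uIcc_of_le zero_le_one]
    exact hβ.continuousOn_canonicalLift hH hr
  -- On an edge where `H` is constant the pullback kills `∂/∂s`, so `G` is constant there.
  have hedge : ∀ t ∈ Icc (0 : ℝ) 1, ∀ x : M, (∀ r ∈ Ioo (-ε) ε, H r t = x) →
      G (s, t) = G (s', t) := by
    intro t ht x hx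
    have hd : ∀ r ∈ Ioo (-ε) ε, HasDerivWithinAt (fun r ↦ G (r, t)) 0 (Ioo (-ε) ε) r := by
      intro r hr
      have h1 : HasDerivWithinAt (fun r : ℝ ↦ (r, t)) ((1 : ℝ), (0 : ℝ)) (Ioo (-ε) ε) r :=
        (hasDerivWithinAt_id r _).prodMk (hasDerivWithinAt_const r _ t)
      have h2 := (hG (r, t) ⟨hr, ht⟩).comp_hasDerivWithinAt r h1 fun z hz ↦ mk_mem_prod hz ht
      rwa [hH.pullbackOneForm_fst β hr ht hx] at h2
    refine (convex_Ioo (-ε) ε).is_const_of_fderivWithin_eq_zero (𝕜 := ℝ)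
      (f := fun r ↦ G (r, t))
      (fun r hr ↦ (hd r hr).differentiableWithinAt) (fun r hr ↦ ?_) hs hs'
    rw [(hd r hr).hasFDerivWithinAt.fderivWithin (uniqueDiffOn_Ioo _ _ r hr)]
    ext
    simp
  rw [hint s hs, hint s' hs', hedge 1 (by simp) _ hH.right, hedge 0 (by simp) _ hH.left]

/-- `F` is smooth only off the zero section, so nearby curves must be regular for their lengths to
be handled. Positivity of `a(v, v)` is an open condition, and compactness of `[0, 1]` makes it
uniform in `t`. -/
theorem IsProperVariation.eventually_canonicalLift_ne_zero
    (hH : IsProperVariation (n := n) γ ε H) (a : SmoothRiemannianMetric n M)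
    (hγ : ∀ t ∈ Icc (0 : ℝ) 1, (canonicalLift (n := n) γ t).snd ≠ 0) :
    ∀ᶠ s in 𝓝 (0 : ℝ), ∀ t ∈ Icc (0 : ℝ) 1, (canonicalLift (n := n) (H s) t).snd ≠ 0 := by
  have h0 : (0 : ℝ) ∈ Ioo (-ε) ε := by simp [hH.pos]
  have hc : Continuous fun p : TangentBundle (𝓡 n) M ↦ a.inner p.proj p.snd p.snd := by
    let : RiemannianBundle (fun x : M ↦ TangentSpace (𝓡 n) x) := ⟨a.toRiemannianMetric⟩
    have : IsContinuousRiemannianBundle (EuclideanSpace ℝ (Fin n))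
        (fun x : M ↦ TangentSpace (𝓡 n) x) :=
      ⟨a.inner, a.contMDiff.continuous, fun _ _ _ ↦ rfl⟩
    exact Continuous.inner_bundle (F := EuclideanSpace ℝ (Fin n))
      (b := fun p : TangentBundle (𝓡 n) M ↦ p.proj) (v := fun p ↦ p.snd) (w := fun p ↦ p.snd)
      continuous_id continuous_id
  -- Neighbourhoods of `(0, t)` in the plane leave the strip when `t` is an end point, hence the
  -- extra membership hypothesis.
  have key : ∀ᶠ s in 𝓝 (0 : ℝ), ∀ t ∈ Icc (0 : ℝ) 1, (s, t) ∈ Ioo (-ε) ε ×ˢ Icc (0 : ℝ) 1 →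
      (canonicalLift (n := n) (H s) t).snd ≠ 0 := by
    refine isCompact_Icc.eventually_forall_of_forall_eventually fun t ht ↦ ?_
    have hcw := hc.comp_continuousOn hH.continuousOn_canonicalLift (0, t) ⟨h0, ht⟩
    have hne : (canonicalLift (n := n) (H 0) t).snd ≠ 0 := by
      have : canonicalLift (n := n) (H 0) t = canonicalLift γ t := by
        unfold canonicalLift
        rw [mfderivWithin_congr hH.base (hH.base t ht), hH.base t ht]
      rw [this]
      exact hγ t ht
    have hpos := hcw.eventually (lt_mem_nhds (a.pos _ _ hne))
    filter_upwards [eventually_nhdsWithin_iff.1 hpos] with z hz hzs hz0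
    have := hz hzs
    simp [hz0] at this
  filter_upwards [key, Ioo_mem_nhds h0.1 h0.2] with s hs hsε t ht
  exact hs t ht ⟨hsε, ht⟩

end Variation

/-! ### Reversal of curves and of the metric -/

section Reverse

variable {n : ℕ} {M : Type*} [TopologicalSpace M] [ChartedSpace (EuclideanSpace ℝ (Fin n)) M]

theorem mapsTo_one_sub_Icc : MapsTo (fun t : ℝ ↦ 1 - t) (Icc 0 1) (Icc 0 1) :=
  fun t ht ↦ ⟨by linarith [ht.2], by linarith [ht.1]⟩

theorem contMDiff_one_sub : ContMDiff 𝓘(ℝ, ℝ) 𝓘(ℝ, ℝ) ∞ (fun t : ℝ ↦ 1 - t) :=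
  contMDiff_iff_contDiff.2 (contDiff_const.sub contDiff_id)

theorem canonicalLift_reverse {γ : ℝ → M} (hγ : ContMDiffOn 𝓘(ℝ, ℝ) (𝓡 n) ∞ γ (Icc 0 1))
    {t : ℝ} (ht : t ∈ Icc (0 : ℝ) 1) :
    canonicalLift (n := n) (fun t ↦ γ (1 - t)) t =
      ⟨γ (1 - t), -(canonicalLift (n := n) γ (1 - t)).snd⟩ := by
  have h1 : HasMFDerivWithinAt 𝓘(ℝ, ℝ) 𝓘(ℝ, ℝ) (fun t : ℝ ↦ 1 - t) (Icc 0 1) t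
      (-ContinuousLinearMap.id ℝ ℝ) :=
    ((hasFDerivAt_id t).const_sub 1).hasFDerivWithinAt.hasMFDerivWithinAt
  have h2 := ((hγ _ (mapsTo_one_sub_Icc ht)).mdifferentiableWithinAt (by simp)).hasMFDerivWithinAt
  have h3 := (h2.comp t h1 mapsTo_one_sub_Icc).mfderivWithin
    (uniqueDiffOn_Icc_zero_one t ht).uniqueMDiffWithinAt
  have h4 := DFunLike.congr_fun h3 (1 : ℝ)
  have h5 := h4.trans (map_neg (mfderivWithin 𝓘(ℝ, ℝ) (𝓡 n) γ (Icc 0 1) (1 - t)) (1 : ℝ))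
  exact congrArg (fun v ↦ (⟨γ (1 - t), v⟩ : TangentBundle (𝓡 n) M)) h5

theorem finslerLength_reverse {γ : ℝ → M} (hγ : ContMDiffOn 𝓘(ℝ, ℝ) (𝓡 n) ∞ γ (Icc 0 1))
    (F : TangentBundle (𝓡 n) M → ℝ) :
    finslerLength F (fun t ↦ γ (1 - t)) =
      finslerLength (fun p : TangentBundle (𝓡 n) M ↦ F ⟨p.proj, -p.snd⟩) γ := by
  have h : finslerLength F (fun t ↦ γ (1 - t)) = ∫ t in (0 : ℝ)..1,
      (fun r ↦ F ⟨(canonicalLift (n := n) γ r).proj, -(canonicalLift (n := n) γ r).snd⟩)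
        (1 - t) := by
    refine intervalIntegral.integral_congr fun t ht ↦ ?_
    rw [uIcc_of_le zero_le_one] at ht
    exact congrArg F (canonicalLift_reverse hγ ht)
  rw [h, intervalIntegral.integral_comp_sub_left (fun r ↦
    F ⟨(canonicalLift (n := n) γ r).proj, -(canonicalLift (n := n) γ r).snd⟩), sub_self, sub_zero]
  rfl

theorem IsProperVariation.reverse {γ : ℝ → M} {ε : ℝ} {H : ℝ → ℝ → M}
    (hH : IsProperVariation (n := n) γ ε H) :
    IsProperVariation (n := n) (fun t ↦ γ (1 - t)) ε (fun s t ↦ H s (1 - t)) where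
  pos := hH.pos
  smooth := by
    have h : ContMDiff 𝓘(ℝ, ℝ × ℝ) 𝓘(ℝ, ℝ × ℝ) ∞ (fun q : ℝ × ℝ ↦ (q.1, 1 - q.2)) :=
      contMDiff_iff_contDiff.2 (by fun_prop)
    exact hH.smooth.comp h.contMDiffOn fun q hq ↦ ⟨hq.1, mapsTo_one_sub_Icc hq.2⟩
  base t ht := hH.base _ (mapsTo_one_sub_Icc ht)
  left s hs := by simpa using hH.right s hs
  right s hs := by simpa using hH.left s hs

theorem IsProperVariation.contMDiffOn {γ : ℝ → M} {ε : ℝ} {H : ℝ → ℝ → M}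
    (hH : IsProperVariation (n := n) γ ε H) {s : ℝ} (hs : s ∈ Ioo (-ε) ε) :
    ContMDiffOn 𝓘(ℝ, ℝ) (𝓡 n) ∞ (H s) (Icc 0 1) := by
  have h : ContMDiff 𝓘(ℝ, ℝ) 𝓘(ℝ, ℝ × ℝ) ∞ (fun t : ℝ ↦ (s, t)) :=
    contMDiff_iff_contDiff.2 (by fun_prop)
  exact hH.smooth.comp h.contMDiffOn fun t ht ↦ ⟨hs, ht⟩

variable [IsManifold (𝓡 n) ∞ M]

/-- A metric whose reverse differs from it by a closed `1`-form has reversible geodesics. -/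
theorem hasReversibleGeodesics_of_reverse_eq_sub {F : TangentBundle (𝓡 n) M → ℝ}
    (hF : ContMDiffOn (𝓡 n).tangent 𝓘(ℝ, ℝ) ∞ F {p | p.snd ≠ 0})
    (a : SmoothRiemannianMetric n M)
    {β : (x : M) → TangentSpace (𝓡 n) x →L[ℝ] ℝ} (hβ : IsSmoothOneForm β)
    (hβ' : IsClosedOneForm β) (c : ℝ)
    (hrev : ∀ p : TangentBundle (𝓡 n) M, F ⟨p.proj, -p.snd⟩ = F p - c * β p.proj p.snd) :
    HasReversibleGeodesics F := by
  intro γ hγ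
  refine ⟨hγ.smooth.comp contMDiff_one_sub.contMDiffOn mapsTo_one_sub_Icc, fun t ht ↦ ?_,
    fun ε K hK ↦ ?_⟩
  · rw [canonicalLift_reverse hγ.smooth ht]
    exact neg_ne_zero.2 (hγ.regular _ (mapsTo_one_sub_Icc ht))
  · have hH : IsProperVariation (n := n) γ ε (fun s t ↦ K s (1 - t)) := by
      simpa using hK.reverse
    have h0 : (0 : ℝ) ∈ Ioo (-ε) ε := by simp [hK.pos]
    -- The subtracted integral is frozen at `s = 0` by closedness, so it is a constant and does not
    -- affect the derivative.
    have hev : (fun s ↦ finslerLength F (K s)) =ᶠ[𝓝 0]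
        fun s ↦ finslerLength F (fun t ↦ K s (1 - t)) -
          c * finslerLength (fun p : TangentBundle (𝓡 n) M ↦ β p.proj p.snd)
            (fun t ↦ K 0 (1 - t)) := by
      filter_upwards [hH.eventually_canonicalLift_ne_zero a hγ.regular,
        Ioo_mem_nhds h0.1 h0.2] with s hs hsε
      have h1 := finslerLength_reverse (hH.contMDiffOn hsε) F
      simp only [sub_sub_cancel] at h1
      have hFi : IntervalIntegrable
          (fun t ↦ F (canonicalLift (n := n) (fun t ↦ K s (1 - t)) t)) MeasureTheory.volume 0 1 := by
        apply ContinuousOn.intervalIntegrable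
        rw [uIcc_of_le zero_le_one]
        exact hF.continuousOn.comp (hH.continuousOn_canonicalLift_right hsε) hs
      have hβi : IntervalIntegrable
          (fun t ↦ β (canonicalLift (n := n) (fun t ↦ K s (1 - t)) t).proj
            (canonicalLift (n := n) (fun t ↦ K s (1 - t)) t).snd) MeasureTheory.volume 0 1 := by
        apply ContinuousOn.intervalIntegrable
        rw [uIcc_of_le zero_le_one]
        exact hβ.continuousOn_canonicalLift hH hsε
      rw [h1, ← hβ'.integral_canonicalLift_eq hβ hH hsε h0]
      simp only [finslerLength, hrev]
      rw [intervalIntegral.integral_sub hFi (hβi.const_mul c), intervalIntegral.integral_const_mul]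
    exact ((hγ.critical ε _ hH).sub_const _).congr_of_eventuallyEq hev

theorem alphaBeta_neg (a : SmoothRiemannianMetric n M)
    (β : (x : M) → TangentSpace (𝓡 n) x →L[ℝ] ℝ) {φ : ℝ → ℝ} {k c : ℝ}
    (hφ : ∀ s, φ s = s ^ 2 + k * s + c) (p : TangentBundle (𝓡 n) M) :
    alphaBeta a β φ ⟨p.proj, -p.snd⟩ = alphaBeta a β φ p - 2 * k * β p.proj p.snd := by
  have hα : riemannianNorm a ⟨p.proj, -p.snd⟩ = riemannianNorm a p := by
    simp [riemannianNorm]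
  have hβ : β p.proj (-p.snd) = -β p.proj p.snd := map_neg _ _
  unfold alphaBeta
  simp only [hα, hβ, hφ]
  -- At a zero vector `α = 0` and both sides vanish; elsewhere one may divide by `α`.
  by_cases h0 : p.snd = 0
  · simp [riemannianNorm, h0]
  · have hne : riemannianNorm a p ≠ 0 := (Real.sqrt_pos.2 (a.pos _ _ h0)).ne'
    field_simp
    ring

end Reverse

theorem theorem3p4 (n : ℕ) (hn : 3 ≤ n) (M : Type*) [TopologicalSpace M] [T2Space M]
    [SecondCountableTopology M] [ConnectedSpace M]
    [ChartedSpace (EuclideanSpace ℝ (Fin n)) M] [IsManifold (𝓡 n) ∞ M]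
    (a : SmoothRiemannianMetric n M)
    (β : (x : M) → TangentSpace (𝓡 n) x →L[ℝ] ℝ)
    (hβ_smooth : IsSmoothOneForm β) (hβ_closed : IsClosedOneForm β)
    (φ : ℝ → ℝ)
    (hφ : (∀ s, φ s = s ^ 2 + 2 * s + 2) ∨ (∀ s, φ s = s ^ 2 + s + 2) ∨
      (∀ s, φ s = (s + 2) ^ 2))
    (hF : IsFinslerMetric (alphaBeta a β φ))
    (hF_nonRiemannian : ¬ IsRiemannianNorm (alphaBeta a β φ)) :
    HasReversibleGeodesics (alphaBeta a β φ) := by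
  obtain ⟨k, c, h⟩ : ∃ k c : ℝ, ∀ s, φ s = s ^ 2 + k * s + c := by
    rcases hφ with h | h | h
    · exact ⟨2, 2, h⟩
    · exact ⟨1, 2, fun s ↦ by rw [h, one_mul]⟩
    · exact ⟨4, 4, fun s ↦ by rw [h]; ring⟩
  exact hasReversibleGeodesics_of_reverse_eq_sub hF.smooth a hβ_smooth hβ_closed (2 * k)
    (alphaBeta_neg a β h)
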